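/- Let $\Sigma$ be a finite alphabet. For a word $w\in\Sigma^*$ let $\mathsf{Facs}(w)=\{u\in\Sigma^* : w=xuy \text{ for some } x,y\in\Sigma^*\}$ be the set of its factors, and let $\mathfrak A_w$ be the following first-order structure. Its universe is $\mathsf{Facs}(w)\cup\{\perp\}$, where $\perp$ is an additional null element; it has one ternary relation $R_\circ=\{(a,b,c)\in\mathsf{Facs}(w)^3 : a=bc\}$; and it has a constant symbol $\varepsilon$, interpreted by the empty word, and for every letter $\mathtt a\in\Sigma$ a constant symbol $\mathtt a$, interpreted by the word $\mathtt a$ if this letter occurs in $w$ and by $\perp$ otherwise. For $k\in\mathbb N=\{0,1,2,\dots\}$ and $w,v\in\Sigma^*$, write $w\equiv_k v$ if Duplicator has a winning strategy in the $k$-round Ehrenfeucht–Fraïssé game on $\mathfrak A_w$ and $\mathfrak A_v$: in round $i$, Spoiler picks an element of one of the two structures (of its choice) and Duplicator answers with an element of the other one, giving $a_i$ in $\mathfrak A_w$ and $b_i$ in $\mathfrak A_v$. Let $\vec a$ and $\vec b$ be the tuples $(a_1,\dots,a_k)$ and $(b_1,\dots,b_k)$, each followed by the values of all the constant symbols (in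 the same order) in the respective structure. Duplicator wins if $(\vec a,\vec b)$ is a partial isomorphism, that is, for all indices $i,j,l$ and all constant symbols $c$: $a_i=c^{\mathfrak A_w}$ if and only if $b_i=c^{\mathfrak A_v}$; $a_i=a_j$ if and only if $b_i=b_j$; and $(a_i,a_j,a_l)\in R_\circ^{\mathfrak A_w}$ if and only if $(b_i,b_j,b_l)\in R_\circ^{\mathfrak A_v}$. **Proposition.** For every nonempty word $w\in\Sigma^*$ and every $k\in\mathbb N$, there exist $p\in\mathbb N$ with $p\ge 1$ and a word $v\in\Sigma^*$ such that $w^p\equiv_k v$ and $w^p\neq v$. -/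

import Mathlib

/-!
Words over `α` are the elements of Mathlib's free monoid `FreeMonoid α`: `1` is the empty word,
`*` is concatenation and `w ^ p` is the `p`-fold repetition of `w`.
-/

namespace FC

/-- The set of all factors of the word `w`. -/
def Facs {α : Type*} (w : FreeMonoid α) : Set (FreeMonoid α) :=
  {u | ∃ x y : FreeMonoid α, w = x * u * y}

theorem one_mem_facs {α : Type*} (w : FreeMonoid α) : (1 : FreeMonoid α) ∈ Facs w :=
  ⟨1, w, by simp⟩

theorem of_mem_facs {α : Type*} {a : α} {w : FreeMonoid α} (h : a ∈ w) :
    FreeMonoid.of a ∈ Facs w := by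
  obtain ⟨s, t, hst⟩ := List.append_of_mem (a := a) (l := FreeMonoid.toList w) h
  refine ⟨FreeMonoid.ofList s, FreeMonoid.ofList t, ?_⟩
  apply FreeMonoid.toList.injective
  simp [hst]

/-- The function symbols of the signature: one constant symbol for every letter, and one for the
empty word. -/
inductive Func (α : Type*) : ℕ → Type _
  | letter (a : α) : Func α 0
  | eps : Func α 0

/-- The relation symbols of the signature: one ternary symbol, for concatenation. -/
inductive Rel : ℕ → Type
  | conc : Rel 3

/-- The signature consisting of a ternary relation symbol for concatenation and of constant symbols
for the letters and for the empty word. -/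
def sig (α : Type*) : FirstOrder.Language where
  Functions := Func α
  Relations := Rel

/-- The universe of the structure representing `w`: the factors of `w` together with a null
element `⊥`, which is `none`. -/
abbrev Univ {α : Type*} (w : FreeMonoid α) : Type _ := Option (Facs w)

open Classical in
/-- The interpretation of the constant symbols: a letter stands for itself if it occurs in `w`, and
for the null element otherwise; `eps` stands for the empty word. -/
noncomputable def interpFunc {α : Type*} (w : FreeMonoid α) :
    {n : ℕ} → Func α n → (Fin n → Univ w) → Univ w
  | _, Func.letter a, _ => if h : a ∈ w then some ⟨FreeMonoid.of a, of_mem_facs h⟩ else none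
  | _, Func.eps, _ => some ⟨1, one_mem_facs w⟩

/-- The interpretation of the relation symbol: all triples `(a, b, c)` of factors of `w` such that
`a = b * c`. -/
def interpRel {α : Type*} (w : FreeMonoid α) :
    {n : ℕ} → Rel n → (Fin n → Univ w) → Prop
  | _, Rel.conc, t => ∃ a b c : Facs w,
      t 0 = some a ∧ t 1 = some b ∧ t 2 = some c ∧
        (a : FreeMonoid α) = (b : FreeMonoid α) * (c : FreeMonoid α)

/-- The structure representing the word `w`. -/
noncomputable instance {α : Type*} (w : FreeMonoid α) : (sig α).Structure (Univ w) where
  funMap := interpFunc w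
  RelMap := interpRel w

/-- The concatenation relation of the structure representing `w`. -/
def Conc {α : Type*} {w : FreeMonoid α} (a b c : Univ w) : Prop :=
  FirstOrder.Language.Structure.RelMap (L := sig α) Rel.conc ![a, b, c]

/-- The value of a constant symbol in the structure representing `w`. -/
noncomputable def const {α : Type*} (w : FreeMonoid α) (c : Func α 0) : Univ w :=
  FirstOrder.Language.Structure.funMap (L := sig α) c ![]

/-- The two families `a` and `b` define a partial isomorphism between the structures representing
`w` and `v`. -/
structure IsPartialIso {α ι : Type*} {w v : FreeMonoid α} (a : ι → Univ w) (b : ι → Univ v) :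
    Prop where
  const_iff : ∀ (i : ι) (c : Func α 0), a i = const w c ↔ b i = const v c
  eq_iff : ∀ i j : ι, a i = a j ↔ b i = b j
  conc_iff : ∀ i j k : ι, Conc (a i) (a j) (a k) ↔ Conc (b i) (b j) (b k)

/-- Duplicator has a winning strategy for the remaining `k` rounds of the Ehrenfeucht-Fraïssé game
on the structures representing `w` and `v`, when the elements `a 0, …, a (n - 1)` and
`b 0, …, b (n - 1)` have been chosen in the first `n` rounds. In every round Spoiler picks an element
of one of the two structures and Duplicator answers with an element of the other one. When no rounds
remain, Duplicator has won if the chosen elements, followed by the values of all constant symbols,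
define a partial isomorphism. -/
def DuplicatorWins {α : Type*} {w v : FreeMonoid α} :
    (k : ℕ) → {n : ℕ} → (Fin n → Univ w) → (Fin n → Univ v) → Prop
  | 0, _, a, b => IsPartialIso (Sum.elim a (const w)) (Sum.elim b (const v))
  | k + 1, n, a, b =>
      (∀ x : Univ w, ∃ y : Univ v, DuplicatorWins k
        (Fin.snoc a x : Fin (n + 1) → Univ w) (Fin.snoc b y : Fin (n + 1) → Univ v)) ∧
      (∀ y : Univ v, ∃ x : Univ w, DuplicatorWins k
        (Fin.snoc a x : Fin (n + 1) → Univ w) (Fin.snoc b y : Fin (n + 1) → Univ v))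

/-- `w ≡ₖ v`: Duplicator has a winning strategy for the `k`-round game on the structures
representing `w` and `v`. -/
def GameEquiv {α : Type*} (k : ℕ) (w v : FreeMonoid α) : Prop :=
  DuplicatorWins k (Fin.elim0 : Fin 0 → Univ w) (Fin.elim0 : Fin 0 → Univ v)

end FC

namespace FC

/-! The signature is finite and relational apart from constants, so for fixed `k` only finitely many
`k`-round types exist (`exists_finite_classification`). The positive powers of a nonempty word are
infinitely many distinct words (`pow_injective_of_ne_one`), so by pigeonhole two of them share a
type. -/

instance finite_func_zero {α : Type*} [Finite α] : Finite (Func α 0) := by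
  refine Finite.of_surjective
    (fun o : Option α => (o.elim Func.eps Func.letter : Func α 0)) ?_
  rintro (a | _)
  · exact ⟨some a, rfl⟩
  · exact ⟨none, rfl⟩

/-- Positions with `n` chosen elements are classified by finitely many types such that Duplicator
wins the game with `k` remaining rounds between any two positions of the same type. -/
theorem exists_finite_classification.{u} {α : Type u} [Finite α] (k : ℕ) : ∀ n : ℕ,
    ∃ (T : Type u) (_ : Finite T) (f : (w : FreeMonoid α) → (Fin n → Univ w) → T),
      ∀ (w v : FreeMonoid α) (a : Fin n → Univ w) (b : Fin n → Univ v),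
        f w a = f v b → DuplicatorWins k a b := by
  induction k with
  | zero =>
    intro n
    let ι := Fin n ⊕ Func α 0
    let ext (w : FreeMonoid α) (a : Fin n → Univ w) : ι → Univ w := Sum.elim a (const w)
    -- The type is the atomic diagram: one set per clause of `IsPartialIso`. It is finite because
    -- `ι` is, which uses the finite alphabet.
    refine ⟨Set (ι × Func α 0) × Set (ι × ι) × Set (ι × ι × ι), inferInstance,
      fun w a => ({p | ext w a p.1 = const w p.2}, {p | ext w a p.1 = ext w a p.2},
        {p | Conc (ext w a p.1) (ext w a p.2.1) (ext w a p.2.2)}), ?_⟩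
    intro w v a b h
    have h₁ := congrArg Prod.fst h
    have h₂ := congrArg (fun t => t.2.1) h
    have h₃ := congrArg (fun t => t.2.2) h
    exact ⟨fun i c => Set.ext_iff.mp h₁ (i, c), fun i j => Set.ext_iff.mp h₂ (i, j),
      fun i j l => Set.ext_iff.mp h₃ (i, j, l)⟩
  | succ k ih =>
    intro n
    obtain ⟨T, _, f, hf⟩ := ih (n + 1)
    -- The type records which types one further move can reach; equality of these sets gives
    -- Duplicator an answer to a move on either side.
    refine ⟨Set T, inferInstance,
      fun w a => Set.range fun x => f w (Fin.snoc a x : Fin (n + 1) → Univ w), ?_⟩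
    intro w v a b h
    constructor
    · intro x
      obtain ⟨y, hy⟩ := h.subset ⟨x, rfl⟩
      exact ⟨y, hf _ _ _ _ hy.symm⟩
    · intro y
      obtain ⟨x, hx⟩ := h.superset ⟨y, rfl⟩
      exact ⟨x, hf _ _ _ _ hx⟩

/-- Lengths separate the powers, as `w ^ p` has length `p * w.length` with `w.length` positive. -/
theorem pow_injective_of_ne_one {α : Type*} {w : FreeMonoid α} (hw : w ≠ 1) :
    Function.Injective fun p : ℕ => w ^ p := by
  intro p q h
  have hlen : w.length ≠ 0 := fun h0 => hw (FreeMonoid.length_eq_zero.mp h0)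
  have length_pow (m : ℕ) : (w ^ m).length = m * w.length := by
    induction m with
    | zero => simp
    | succ m ih => rw [pow_succ, FreeMonoid.length_mul, ih, Nat.succ_mul]
  have h' := congrArg FreeMonoid.length h
  simp only [length_pow] at h'
  exact Nat.eq_of_mul_eq_mul_right (Nat.pos_of_ne_zero hlen) h'

end FC

theorem mainTheorem9 {α : Type*} [Finite α] (w : FreeMonoid α) (hw : w ≠ 1) (k : ℕ) :
    ∃ (p : ℕ) (v : FreeMonoid α), 1 ≤ p ∧ FC.GameEquiv k (w ^ p) v ∧ w ^ p ≠ v := by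
  obtain ⟨T, _, f, hf⟩ := FC.exists_finite_classification (α := α) k 0
  -- The shift to `p + 1` keeps the exponent at least 1.
  obtain ⟨p, q, hpq, h⟩ := Finite.exists_ne_map_eq_of_infinite
    fun p : ℕ => f (w ^ (p + 1)) Fin.elim0
  refine ⟨p + 1, w ^ (q + 1), Nat.le_add_left 1 p, hf _ _ _ _ h, fun e => hpq ?_⟩
  exact Nat.succ_injective (FC.pow_injective_of_ne_one hw e)
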